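/- Let $V$ be a 3-dimensional real vector space and let $\Phi\colon V\to[0,\infty)$ be a Banach–Minkowski norm on $V$, that is, a norm that is not required to be symmetric ($\Phi(v)=0$ only for $v=0$; $\Phi(tv)=t\,\Phi(v)$ for $t\ge 0$; $\Phi(v+w)\le\Phi(v)+\Phi(w)$), that is $C^\infty$ on $V\setminus\{0\}$, and for which the second derivative of $\Phi^2$ at every $v\in V\setminus\{0\}$ is positive definite. Let $\mathrm{Gr}_2(V)$ be the Grassmannian of 2-dimensional linear subspaces of $V$ with its standard topology, and let $U\subset\mathrm{Gr}_2(V)$ be an open set such that all normed planes $(H,\Phi|_H)$, $H\in U$, are isometric to each other, i.e. for all $H,H'\in U$ there is a linear bijection $L\colon H\to H'$ with $\Phi(L(v))=\Phi(v)$ for all $v\in H$. Then for every $H\in U$ the norm $\Phi|_H$ is Euclidean, i.e. there is an inner product $\langle\cdot,\cdot\rangle$ on $H$ with $\Phi(v)=\sqrt{\langle v,v\rangle}$ for all $v\in H$. -/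

import Mathlib

open scoped ContDiff

/-- A norm on a real vector space, in the wide sense: it is not required to be symmetric, so
homogeneity is only asked for nonnegative factors. -/
structure IsAsymmetricNorm {E : Type*} [AddCommGroup E] [Module ℝ E] (Φ : E → ℝ) : Prop where
  nonneg : ∀ v, 0 ≤ Φ v
  eq_zero_iff : ∀ v, Φ v = 0 ↔ v = 0
  smul : ∀ (t : ℝ) (v : E), 0 ≤ t → Φ (t • v) = t * Φ v
  add_le : ∀ v w, Φ (v + w) ≤ Φ v + Φ w

/-- A Banach–Minkowski norm: a possibly non-symmetric norm that is smooth outside `0` and whose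
square is quadratically strictly convex, i.e. has positive definite second derivative at every
nonzero vector. The norm that `V` carries as a Mathlib normed space only gives a meaning to
derivatives; for a finite-dimensional `V` its choice is irrelevant. -/
structure IsBanachMinkowskiNorm {V : Type*} [NormedAddCommGroup V] [NormedSpace ℝ V]
    (Φ : V → ℝ) : Prop extends IsAsymmetricNorm Φ where
  smooth : ContDiffOn ℝ ∞ Φ {0}ᶜ
  strictConvex : ∀ v w : V, v ≠ 0 → w ≠ 0 →
    0 < fderiv ℝ (fderiv ℝ (fun x => Φ x ^ 2)) v w w

/-- The Grassmannian of `k`-dimensional linear subspaces of `V`. -/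
structure Gr (k : ℕ) (V : Type*) [AddCommGroup V] [Module ℝ V] where
  toSubmodule : Submodule ℝ V
  finrank_eq : Module.finrank ℝ toSubmodule = k

/-- The subspace spanned by a linearly independent `k`-tuple, as a point of the Grassmannian. -/
def Gr.ofFrame {k : ℕ} {V : Type*} [AddCommGroup V] [Module ℝ V]
    (f : {f : Fin k → V // LinearIndependent ℝ f}) : Gr k V where
  toSubmodule := Submodule.span ℝ (Set.range f.1)
  finrank_eq := by simpa using finrank_span_eq_card f.2

/-- The standard topology of the Grassmannian: the quotient topology from the space of linearly
independent `k`-tuples. -/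
instance Gr.instTopologicalSpace (k : ℕ) (V : Type*) [AddCommGroup V] [Module ℝ V]
    [TopologicalSpace V] : TopologicalSpace (Gr k V) :=
  TopologicalSpace.coinduced Gr.ofFrame inferInstance

/-- Two (possibly non-symmetric) normed vector spaces `(E, φ)` and `(F, ψ)` are isometric if there
is a norm-preserving linear bijection between them. -/
def AreIsometric {E F : Type*} [AddCommGroup E] [Module ℝ E] [AddCommGroup F] [Module ℝ F]
    (φ : E → ℝ) (ψ : F → ℝ) : Prop :=
  ∃ L : E ≃ₗ[ℝ] F, ∀ v, ψ (L v) = φ v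

/-- A norm is Euclidean if it is associated with an inner product. -/
def IsEuclideanNorm {E : Type*} [AddCommGroup E] [Module ℝ E] (φ : E → ℝ) : Prop :=
  ∃ c : InnerProductSpace.Core ℝ E, ∀ v, φ v = √(c.inner v v)

/-- The restriction of a function on `V` to a point of the Grassmannian. -/
def Gr.restrict {k : ℕ} {V : Type*} [AddCommGroup V] [Module ℝ V] (Φ : V → ℝ) (H : Gr k V) :
    H.toSubmodule → ℝ :=
  fun v => Φ v

/-! Write `P = Φ ^ 2` and suppose that no plane in `U` is Euclidean. On a plane, a nonzero linear
field annihilated by the differential of the squared norm generates a flow of isometries, whose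
orbits must be ellipses; so such a field makes the norm Euclidean (`isEuclideanNorm_of_linear`), and
a quadratic field can be reduced to a linear one (`isEuclideanNorm_of_quadratic`).

Fix `H ∈ U` and `e ∉ H`. Tilting `H` to the graphs `x + t l(x) e` and differentiating the isometries
with `H` gives `dP_x(R x) = l(x) dP_x(e)` with `R` linear. Eliminating `dP_x(e)` between two
coordinates `l` yields a quadratic field, which must vanish; this forces `R x = l(x) w` with a
common `w`. Hence the direction `e - w` satisfies `dP_x(e - w) = 0` along all of `H`
(`exists_conjugate_direction`).

This holds for every plane in `U`, so it may be differentiated again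
(`exists_derivative_of_conjugate_direction`): with `e` now that direction, `dP_x(W) = l(x) P''_x(e,
e)` for some `W ∈ H`. Eliminating between two coordinates gives a linear field, which must vanish as
well; then `P''(e, e) = 0` at some point, against strict convexity. -/

/-! ### Infinitesimal isometries of normed planes. -/

section Euclidean

variable {E : Type*} [NormedAddCommGroup E] [NormedSpace ℝ E] {φ : E → ℝ}

theorem IsAsymmetricNorm.pos (hφ : IsAsymmetricNorm φ) {v : E} (hv : v ≠ 0) : 0 < φ v :=
  lt_of_le_of_ne (hφ.nonneg v) fun h => hv ((hφ.eq_zero_iff v).1 h.symm)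

/-- Euler's identity for the square of an asymmetric norm. -/
theorem IsAsymmetricNorm.euler (hφ : IsAsymmetricNorm φ) {x : E} {D : E →L[ℝ] ℝ}
    (hD : HasFDerivAt (fun x => φ x ^ 2) D x) : D x = 2 * φ x ^ 2 := by
  have h1 : HasDerivAt (fun t : ℝ => t • x) x 1 := by
    simpa using (hasDerivAt_id (1 : ℝ)).smul_const x
  have h2 : HasDerivAt (fun t : ℝ => φ (t • x) ^ 2) (D x) 1 := by
    have hD' : HasFDerivAt (fun x => φ x ^ 2) D ((1 : ℝ) • x) := by simpa using hD
    exact hD'.comp_hasDerivAt (1 : ℝ) h1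
  have h3 : HasDerivAt (fun t : ℝ => t ^ 2 * φ x ^ 2) (2 * φ x ^ 2) 1 := by
    simpa using (hasDerivAt_pow 2 (1 : ℝ)).mul_const (φ x ^ 2)
  refine h2.unique (h3.congr_of_eventuallyEq ?_)
  filter_upwards [lt_mem_nhds (zero_lt_one' ℝ)] with t ht
  rw [hφ.smul t x ht.le, mul_pow]

/-- By Euler's identity the radial derivative is positive. This excludes nonzero real eigenvalues of
an infinitesimal isometry. -/
theorem IsAsymmetricNorm.eq_zero_of_apply_smul (hφ : IsAsymmetricNorm φ) {x : E} {D : E →L[ℝ] ℝ}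
    (hD : HasFDerivAt (fun x => φ x ^ 2) D x) (hx : x ≠ 0) {μ : ℝ} (h : D (μ • x) = 0) :
    μ = 0 := by
  rw [map_smul, hφ.euler hD, smul_eq_mul] at h
  have := hφ.pos hx
  rcases mul_eq_zero.1 h with h | h
  · exact h
  · exact absurd h (by positivity)

theorem IsAsymmetricNorm.not_constant_on_line (hφ : IsAsymmetricNorm φ) {u w : E} (hw : w ≠ 0)
    (h : ∀ t : ℝ, φ (u + t • w) = φ u) : False := by
  have hw' := hφ.pos hw
  -- Chosen so that `φ (t • w)` exceeds by 1 the bound `φ u + φ (-u)` given by the triangle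
  -- inequality.
  set t := (φ u + φ (-u) + 1) / φ w with ht
  have ht0 : 0 ≤ t := div_nonneg (by linarith [hφ.nonneg u, hφ.nonneg (-u)]) hw'.le
  have h1 := hφ.add_le (u + t • w) (-u)
  rw [h t, show u + t • w + -u = t • w by abel, hφ.smul t w ht0, ht, div_mul_cancel₀ _ hw'.ne'] at h1
  linarith

/-- The squared norm is constant along the trajectories of a vector field annihilated by its
differential. -/
theorem IsAsymmetricNorm.eq_of_trajectory (hφ : IsAsymmetricNorm φ) {D : E → E →L[ℝ] ℝ}
    (hD : ∀ x ≠ 0, HasFDerivAt (fun x => φ x ^ 2) (D x) x) {X : E → E}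
    (hX : ∀ x ≠ 0, D x (X x) = 0) {γ : ℝ → E} (hγ : ∀ t, HasDerivAt γ (X (γ t)) t)
    (hγ0 : ∀ t, γ t ≠ 0) (s t : ℝ) : φ (γ s) = φ (γ t) := by
  have h : ∀ t, HasDerivAt (fun t => φ (γ t) ^ 2) 0 t := fun t => by
    have := (hD _ (hγ0 t)).comp_hasDerivAt t (hγ t)
    rwa [hX _ (hγ0 t)] at this
  have h2 := is_const_of_deriv_eq_zero (fun t => (h t).differentiableAt) (fun t => (h t).deriv) s t
  exact (sq_eq_sq₀ (hφ.nonneg _) (hφ.nonneg _)).1 h2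

theorem exists_coordinates_of_finrank_two (hE : Module.finrank ℝ E = 2) {x y : E}
    (hxy : LinearIndependent ℝ ![x, y]) :
    ∃ b : Module.Basis (Fin 2) ℝ E, b 0 = x ∧ b 1 = y :=
  ⟨basisOfLinearIndependentOfCardEqFinrank hxy (by simp [hE]), by simp, by simp⟩

theorem Module.Basis.eq_add_fin_two (b : Module.Basis (Fin 2) ℝ E) (z : E) :
    z = b.coord 0 z • b 0 + b.coord 1 z • b 1 := by
  conv_lhs => rw [← b.sum_repr z, Fin.sum_univ_two]
  rfl

/-- A norm on a plane whose unit circle is an ellipse is Euclidean. -/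
theorem IsAsymmetricNorm.isEuclideanNorm_of_forall_cos_sin (hφ : IsAsymmetricNorm φ)
    (b : Module.Basis (Fin 2) ℝ E)
    (h : ∀ θ : ℝ, φ (Real.cos θ • b 0 + Real.sin θ • b 1) = φ (b 0)) : IsEuclideanNorm φ := by
  set c := φ (b 0) with hc
  have hc0 : 0 < c := hφ.pos (b.ne_zero 0)
  have key : ∀ z, φ z = √(c ^ 2 * (b.coord 0 z * b.coord 0 z + b.coord 1 z * b.coord 1 z)) := by
    intro z
    set w : ℂ := ⟨b.coord 0 z, b.coord 1 z⟩ with hw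
    have h1 : b.coord 0 z = ‖w‖ * Real.cos w.arg := by rw [Complex.norm_mul_cos_arg]
    have h2 : b.coord 1 z = ‖w‖ * Real.sin w.arg := by rw [Complex.norm_mul_sin_arg]
    have h3 : z = ‖w‖ • (Real.cos w.arg • b 0 + Real.sin w.arg • b 1) := by
      conv_lhs => rw [b.eq_add_fin_two z, h1, h2]
      rw [smul_add, smul_smul, smul_smul]
    have h4 : φ z = ‖w‖ * c := by
      conv_lhs => rw [h3]
      rw [hφ.smul _ _ (norm_nonneg _), h]
    have h5 : b.coord 0 z * b.coord 0 z + b.coord 1 z * b.coord 1 z = ‖w‖ ^ 2 := by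
      rw [h1, h2]
      linear_combination ‖w‖ ^ 2 * Real.cos_sq_add_sin_sq w.arg
    rw [h5, h4, ← mul_pow, Real.sqrt_sq (by positivity), mul_comm]
  refine ⟨{ inner := fun u v => c ^ 2 * (b.coord 0 u * b.coord 0 v + b.coord 1 u * b.coord 1 v)
            conj_inner_symm := fun u v => ?_
            re_inner_nonneg := fun u => ?_
            add_left := fun u v w => ?_
            smul_left := fun u v r => ?_
            definite := fun u hu => ?_ }, key⟩
  · simp only [conj_trivial]; ring
  · simp only [RCLike.re_to_real]
    exact mul_nonneg (sq_nonneg _) (add_nonneg (mul_self_nonneg _) (mul_self_nonneg _))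
  · simp only [map_add]; ring
  · simp only [map_smul, smul_eq_mul, conj_trivial]; ring
  · rw [← hφ.eq_zero_iff, key, hu, Real.sqrt_zero]

/-- A norm on a plane with a nonzero infinitesimal linear isometry is Euclidean. -/
theorem IsAsymmetricNorm.isEuclideanNorm_of_linear (hφ : IsAsymmetricNorm φ)
    (hE : Module.finrank ℝ E = 2) {D : E → E →L[ℝ] ℝ}
    (hD : ∀ x ≠ 0, HasFDerivAt (fun x => φ x ^ 2) (D x) x) {A : E →ₗ[ℝ] E} (hA : A ≠ 0)
    (hDA : ∀ x ≠ 0, D x (A x) = 0) : IsEuclideanNorm φ := by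
  have eig : ∀ x ≠ 0, ∀ μ : ℝ, A x = μ • x → μ = 0 := fun x hx μ h =>
    hφ.eq_zero_of_apply_smul (hD x hx) hx (by rw [← h, hDA x hx])
  obtain ⟨x, hx⟩ : ∃ x, A x ≠ 0 := by
    by_contra! h
    exact hA (LinearMap.ext h)
  have hx0 : x ≠ 0 := by rintro rfl; simp at hx
  have hind : LinearIndependent ℝ ![x, A x] := by
    rw [LinearIndependent.pair_iff' hx0]
    intro a ha
    have := eig x hx0 a ha.symm
    rw [this, zero_smul] at ha
    exact hx ha.symm
  have hcomb : ∀ p q : ℝ, p • x + q • A x = 0 → p = 0 ∧ q = 0 :=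
    LinearIndependent.pair_iff.1 hind
  obtain ⟨b, hb0, hb1⟩ := exists_coordinates_of_finrank_two hE hind
  obtain ⟨δ, τ, hAA⟩ : ∃ δ τ : ℝ, A (A x) = (-δ) • x + τ • A x :=
    ⟨-b.coord 0 (A (A x)), b.coord 1 (A (A x)), by
      conv_lhs => rw [b.eq_add_fin_two (A (A x)), hb0, hb1]
      rw [neg_neg]⟩
  -- A real root `r` of the characteristic polynomial `r² - τ r + δ` has the eigenvector `A x - (τ -
  -- r) x`.
  have root : ∀ r : ℝ, r * (τ - r) = δ → r = 0 := by
    intro r hr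
    refine eig (A x - (τ - r) • x) (fun h => ?_) r ?_
    · have := (hcomb (-(τ - r)) 1 (by rw [← h]; module)).2
      norm_num at this
    · rw [map_sub, map_smul, hAA, ← hr]
      module
  rcases le_or_gt (4 * δ) (τ ^ 2) with hdisc | hdisc
  · exfalso
    have hsq : √(τ ^ 2 - 4 * δ) ^ 2 = τ ^ 2 - 4 * δ := Real.sq_sqrt (by linarith)
    set d := √(τ ^ 2 - 4 * δ)
    have h1 := root ((τ + d) / 2) (by linarith)
    have h2 := root ((τ - d) / 2) (by linarith)
    have hτ : τ = 0 := by linarith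
    have hδ : δ = 0 := by
      have hd : d = 0 := by linarith
      rw [hτ, hd] at hsq
      linarith
    -- Both eigenvalues vanish, so the orbit of `x` is the straight line `x + t A x`, on which the
    -- norm cannot be constant.
    rw [hτ, hδ] at hAA
    have hAA : A (A x) = 0 := by rw [hAA]; simp
    refine hφ.not_constant_on_line (u := x) hx fun t => ?_
    have := hφ.eq_of_trajectory hD hDA (γ := fun t => x + t • A x) (fun t => ?_) (fun t h => ?_) t 0
    · simpa using this
    · have h := ((hasDerivAt_id t).smul_const (A x)).const_add x
      simpa [hAA] using h
    · exact one_ne_zero (hcomb 1 t (by simpa using h)).1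
  -- The eigenvalues are `τ/2 ± iν`; in the basis `x, y` the flow of `A` is a rotation of speed `ν`
  -- scaled by `exp (τ t / 2)`.
  · set ν := √(δ - τ ^ 2 / 4) with hν
    have hν0 : 0 < ν := Real.sqrt_pos.2 (by linarith)
    have hν2 : ν ^ 2 = δ - τ ^ 2 / 4 := Real.sq_sqrt (by linarith)
    set y := ν⁻¹ • (A x - (τ / 2) • x) with hy
    have hAx : A x = (τ / 2) • x + ν • y := by
      rw [hy, smul_inv_smul₀ hν0.ne']; abel
    have hAy : A y = (τ / 2) • y - ν • x := by
      have h1 : ν • A y = ν • ((τ / 2) • y - ν • x) := by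
        have h2 : ν • A y = A (A x) - (τ / 2) • A x := by
          rw [hy, map_smul, smul_inv_smul₀ hν0.ne', map_sub, map_smul]
        rw [h2, hAA, hAx]
        have h3 : δ = ν ^ 2 + τ ^ 2 / 4 := by linarith
        rw [h3]
        module
      exact smul_right_injective E hν0.ne' h1
    have hind2 : LinearIndependent ℝ ![x, y] := by
      rw [LinearIndependent.pair_iff]
      intro p q hpq
      have h1 : (p * ν - q * (τ / 2)) • x + q • A x = 0 := by
        have : ν • (p • x + q • y) = 0 := by rw [hpq, smul_zero]
        rw [← this, hAx]; module
      obtain ⟨h2, h3⟩ := hcomb _ _ h1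
      refine ⟨?_, h3⟩
      rw [h3, zero_mul, sub_zero] at h2
      exact (mul_eq_zero.1 h2).resolve_right hν0.ne'
    obtain ⟨b', hb0', hb1'⟩ := exists_coordinates_of_finrank_two hE hind2
    have traj : ∀ s t : ℝ,
        φ (Real.exp (τ / 2 * s) • (Real.cos (ν * s) • x + Real.sin (ν * s) • y)) =
        φ (Real.exp (τ / 2 * t) • (Real.cos (ν * t) • x + Real.sin (ν * t) • y)) := by
      intro s t
      refine hφ.eq_of_trajectory hD hDA
        (γ := fun t => Real.exp (τ / 2 * t) • (Real.cos (ν * t) • x + Real.sin (ν * t) • y))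
        (fun t => ?_) (fun t h => ?_) s t
      · have hm : ∀ k : ℝ, HasDerivAt (fun t : ℝ => k * t) k t := fun k => by
          simpa using (hasDerivAt_id t).const_mul k
        have he := (hm (τ / 2)).exp
        have hc := ((hm ν).cos.smul_const x).add ((hm ν).sin.smul_const y)
        refine (he.smul hc).congr_deriv ?_
        simp only [map_smul, map_add, hAx, hAy, Pi.add_apply]
        module
      · have h1 := (smul_eq_zero.1 h).resolve_left (Real.exp_pos _).ne'
        obtain ⟨h2, h3⟩ := LinearIndependent.pair_iff.1 hind2 _ _ h1
        have := Real.cos_sq_add_sin_sq (ν * t)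
        rw [h2, h3] at this
        norm_num at this
    -- After a full turn the orbit returns to the ray of `x` scaled by `exp (π τ / ν)`; constancy of
    -- the norm makes this factor 1.
    have hτ : τ = 0 := by
      have h1 := traj (2 * Real.pi / ν) 0
      rw [mul_div_cancel₀ _ hν0.ne'] at h1
      simp only [Real.cos_two_pi, Real.sin_two_pi, mul_zero, Real.cos_zero, Real.sin_zero,
        zero_smul, add_zero, one_smul, Real.exp_zero] at h1
      rw [hφ.smul _ _ (Real.exp_pos _).le] at h1
      have h2 := (mul_eq_right₀ (hφ.pos hx0).ne').1 h1
      rw [Real.exp_eq_one_iff] at h2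
      have : 2 * Real.pi / ν ≠ 0 := by positivity
      rcases mul_eq_zero.1 h2 with h | h
      · linarith
      · exact absurd h this
    refine hφ.isEuclideanNorm_of_forall_cos_sin b' fun θ => ?_
    have h1 := traj (θ / ν) 0
    rw [mul_div_cancel₀ _ hν0.ne'] at h1
    simpa [hτ, hb0', hb1'] using h1

/-- A norm on a plane whose differential annihilates a nonzero quadratic vector field is
Euclidean. -/
theorem IsAsymmetricNorm.isEuclideanNorm_of_quadratic (hφ : IsAsymmetricNorm φ)
    (hE : Module.finrank ℝ E = 2) {D : E → E →L[ℝ] ℝ}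
    (hD : ∀ x ≠ 0, HasFDerivAt (fun x => φ x ^ 2) (D x) x) (hDc : ContinuousOn D {0}ᶜ)
    {B : E →ₗ[ℝ] E →ₗ[ℝ] E} (hB : ∃ x, B x x ≠ 0)
    (hDB : ∀ x ≠ 0, D x (B x x) = 0) : IsEuclideanNorm φ := by
  have : FiniteDimensional ℝ E := Module.finite_of_finrank_pos (by omega)
  -- The determinant `q` of `x` and `B x x` is odd under `x ↦ -x`, so it vanishes somewhere on the
  -- circle. There `B x x` is radial, hence zero.
  obtain ⟨x, hx0, hBx⟩ : ∃ x ≠ 0, B x x = 0 := by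
    let b : Module.Basis (Fin 2) ℝ E := Module.finBasisOfFinrankEq ℝ E hE
    let x : ℝ → E := fun θ => Real.cos θ • b 0 + Real.sin θ • b 1
    let q : ℝ → ℝ := fun θ =>
      Real.cos θ * b.coord 1 (B (x θ) (x θ)) - Real.sin θ * b.coord 0 (B (x θ) (x θ))
    have hq : Continuous q := by
      have h1 : ∀ i, Continuous (fun θ => b.coord i (B (x θ) (x θ))) := by
        intro i
        simp only [x, map_add, map_smul, LinearMap.add_apply, LinearMap.smul_apply]
        fun_prop
      have := h1 0
      have := h1 1
      fun_prop
    have hx : ∀ θ, x θ ≠ 0 := by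
      intro θ h
      obtain ⟨h2, h3⟩ := LinearIndependent.pair_iff.1
        (show LinearIndependent ℝ ![b 0, b 1] by
          convert b.linearIndependent using 1
          ext i; fin_cases i <;> rfl) _ _ h
      have := Real.cos_sq_add_sin_sq θ
      rw [h2, h3] at this
      norm_num at this
    obtain ⟨θ, hθ⟩ : ∃ θ, q θ = 0 := by
      have h1 : q Real.pi = -q 0 := by
        have : x Real.pi = -x 0 := by simp [x]
        simp only [q, this]
        simp
      rcases le_total 0 (q 0) with h | h
      · have := intermediate_value_Icc' Real.pi_pos.le hq.continuousOn
          (show (0 : ℝ) ∈ Set.Icc (q Real.pi) (q 0) from ⟨by linarith, h⟩)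
        obtain ⟨θ, -, h⟩ := this
        exact ⟨θ, h⟩
      · have := intermediate_value_Icc Real.pi_pos.le hq.continuousOn
          (show (0 : ℝ) ∈ Set.Icc (q 0) (q Real.pi) from ⟨h, by linarith⟩)
        obtain ⟨θ, -, h⟩ := this
        exact ⟨θ, h⟩
    refine ⟨x θ, hx θ, ?_⟩
    set z := B (x θ) (x θ) with hz
    set μ := Real.cos θ * b.coord 0 z + Real.sin θ * b.coord 1 z
    have hθ' : Real.cos θ * b.coord 1 z - Real.sin θ * b.coord 0 z = 0 := hθ
    have hcs := Real.cos_sq_add_sin_sq θ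
    have h2 : z = μ • x θ := by
      have e0 : b.coord 0 z = μ * Real.cos θ := by
        linear_combination (-b.coord 0 z) * hcs - Real.sin θ * hθ'
      have e1 : b.coord 1 z = μ * Real.sin θ := by
        linear_combination (-b.coord 1 z) * hcs + Real.cos θ * hθ'
      conv_lhs => rw [b.eq_add_fin_two z, e0, e1]
      simp only [x]
      module
    have h3 := hφ.eq_zero_of_apply_smul (hD _ (hx θ)) (hx θ) (μ := μ)
      (by rw [← h2]; exact hDB _ (hx θ))
    rw [h2, h3, zero_smul]
  obtain ⟨y, hxy⟩ : ∃ y, LinearIndependent ℝ ![x, y] :=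
    exists_linearIndependent_pair_of_one_lt_finrank (by omega) hx0
  obtain ⟨b, hb0, hb1⟩ := exists_coordinates_of_finrank_two hE hxy
  -- Since `B x x = 0`, the second coordinate factors out of `B z z`; the cofactor `A` is linear. It
  -- is annihilated off the line spanned by `x`, and by continuity on it.
  let A : E →ₗ[ℝ] E := (b.coord 0).smulRight (B x y + B y x) + (b.coord 1).smulRight (B y y)
  have hBA : ∀ z, B z z = b.coord 1 z • A z := by
    intro z
    have hz := b.eq_add_fin_two z
    rw [hb0, hb1] at hz
    set p := b.coord 0 z with hp
    set q := b.coord 1 z with hq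
    have : A z = p • (B x y + B y x) + q • B y y := rfl
    rw [this, hz]
    simp only [map_add, map_smul, LinearMap.add_apply, LinearMap.smul_apply, hBx]
    module
  have hA0 : A ≠ 0 := by
    rintro h
    obtain ⟨z, hz⟩ := hB
    rw [hBA, h] at hz
    simp at hz
  have hcx : b.coord 1 x = 0 := by rw [← hb0]; simp
  have hcy : b.coord 1 y = 1 := by rw [← hb1]; simp
  have gen : ∀ z ≠ 0, b.coord 1 z ≠ 0 → D z (A z) = 0 := by
    intro z hz hz1
    have := hDB z hz
    rw [hBA, map_smul, smul_eq_mul] at this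
    exact (mul_eq_zero.1 this).resolve_left hz1
  refine hφ.isEuclideanNorm_of_linear hE hD hA0 fun z hz => ?_
  by_cases hz1 : b.coord 1 z = 0
  · have hcont : ContinuousAt (fun t : ℝ => D (z + t • y) (A (z + t • y))) 0 := by
      have h1 : ContinuousAt (fun t : ℝ => z + t • y) 0 := by fun_prop
      have h2 : ContinuousAt D (z + (0 : ℝ) • y) := by
        rw [zero_smul, add_zero]
        exact hDc.continuousAt (isOpen_compl_singleton.mem_nhds hz)
      have h3 : ContinuousAt (fun t : ℝ => A (z + t • y)) 0 := by
        have : Continuous A := A.continuous_of_finiteDimensional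
        fun_prop
      exact (ContinuousAt.comp (f := fun t : ℝ => z + t • y) h2 h1).clm_apply h3
    have h4 : Filter.Tendsto (fun t : ℝ => D (z + t • y) (A (z + t • y))) (nhdsWithin 0 {0}ᶜ)
        (nhds (D z (A z))) := by
      have := hcont.tendsto.mono_left (nhdsWithin_le_nhds (s := {0}ᶜ))
      simpa using this
    refine tendsto_nhds_unique h4 (tendsto_const_nhds.congr' ?_)
    filter_upwards [self_mem_nhdsWithin] with t ht
    have h5 : b.coord 1 (z + t • y) = t := by rw [map_add, map_smul, hz1, hcy]; simp
    refine (gen _ (fun h => ?_) (by rw [h5]; exact ht)).symm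
    rw [h, map_zero] at h5
    exact ht h5.symm
  · exact gen z hz hz1

end Euclidean

/-! ### Limits of normalized directions and differentiation of isometries. -/

section Directions

theorem Filter.Tendsto.clm_apply {ι E F : Type*} [NormedAddCommGroup E] [NormedSpace ℝ E]
    [NormedAddCommGroup F] [NormedSpace ℝ F] {𝓕 : Filter ι} {T : ι → E →L[ℝ] F} {T₀ : E →L[ℝ] F}
    {x : ι → E} {x₀ : E} (hT : Filter.Tendsto T 𝓕 (nhds T₀)) (hx : Filter.Tendsto x 𝓕 (nhds x₀)) :
    Filter.Tendsto (fun i => T i (x i)) 𝓕 (nhds (T₀ x₀)) :=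
  (isBoundedBilinearMap_apply.continuous.tendsto (T₀, x₀)).comp (hT.prodMk_nhds hx)

theorem Ultrafilter.exists_tendsto_of_norm_le {ι F : Type*} [NormedAddCommGroup F]
    [NormedSpace ℝ F] [FiniteDimensional ℝ F] (𝒰 : Ultrafilter ι) {f : ι → F} {M : ℝ}
    (h : ∀ᶠ i in (𝒰 : Filter ι), ‖f i‖ ≤ M) :
    ∃ y, Filter.Tendsto f (𝒰 : Filter ι) (nhds y) := by
  have := FiniteDimensional.proper ℝ F
  obtain ⟨y, -, hy⟩ := (isCompact_closedBall (0 : F) M).ultrafilter_le_nhds' (𝒰.map f) (by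
    rw [Ultrafilter.mem_map]
    filter_upwards [h] with i hi
    simpa using hi)
  exact ⟨y, hy⟩

theorem Ultrafilter.exists_tendsto_normalized {ι F : Type*} [NormedAddCommGroup F]
    [NormedSpace ℝ F] [FiniteDimensional ℝ F] (𝒰 : Ultrafilter ι) {f : ι → F}
    (h : ∀ᶠ i in (𝒰 : Filter ι), f i ≠ 0) :
    ∃ y ≠ 0, Filter.Tendsto (fun i => ‖f i‖⁻¹ • f i) (𝒰 : Filter ι) (nhds y) := by
  have h1 : ∀ᶠ i in (𝒰 : Filter ι), ‖‖f i‖⁻¹ • f i‖ = 1 := by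
    filter_upwards [h] with i hi
    rw [norm_smul, norm_inv, norm_norm, inv_mul_cancel₀ (norm_ne_zero_iff.2 hi)]
  obtain ⟨y, hy⟩ := 𝒰.exists_tendsto_of_norm_le (h1.mono fun i hi => hi.le)
  refine ⟨y, ?_, hy⟩
  have h2 := tendsto_nhds_unique (hy.norm.congr' h1) tendsto_const_nhds
  rintro rfl
  simp at h2

variable {E : Type*} [NormedAddCommGroup E] [NormedSpace ℝ E] {φ : E → ℝ}

theorem IsAsymmetricNorm.continuous [FiniteDimensional ℝ E] (hφ : IsAsymmetricNorm φ) :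
    Continuous φ := by
  have h : ConvexOn ℝ Set.univ φ := by
    refine ⟨convex_univ, fun x _ y _ a b ha hb _ => ?_⟩
    rw [smul_eq_mul, smul_eq_mul, ← hφ.smul a x ha, ← hφ.smul b y hb]
    exact hφ.add_le _ _
  have := h.continuousOn isOpen_univ
  exact continuousOn_univ.1 this

theorem IsAsymmetricNorm.exists_le_mul_norm [FiniteDimensional ℝ E] (hφ : IsAsymmetricNorm φ) :
    ∃ K, 0 ≤ K ∧ ∀ v, φ v ≤ K * ‖v‖ := by
  have := FiniteDimensional.proper ℝ E
  obtain ⟨K, hK⟩ := (isCompact_closedBall (0 : E) 1).exists_bound_of_continuousOn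
    hφ.continuous.continuousOn
  refine ⟨K, (norm_nonneg _).trans (hK 0 (by simp)), fun v => ?_⟩
  rcases eq_or_ne v 0 with rfl | hv
  · simp [(hφ.eq_zero_iff 0).2 rfl]
  have hv' := norm_pos_iff.2 hv
  have h1 := (le_abs_self _).trans (hK (‖v‖⁻¹ • v) (by
    simp [norm_smul, inv_mul_cancel₀ hv'.ne']))
  rw [hφ.smul _ _ (inv_nonneg.2 hv'.le), inv_mul_le_iff₀ hv'] at h1
  linarith

theorem IsAsymmetricNorm.exists_mul_norm_le [FiniteDimensional ℝ E] (hφ : IsAsymmetricNorm φ) :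
    ∃ c > 0, ∀ v, c * ‖v‖ ≤ φ v := by
  have := FiniteDimensional.proper ℝ E
  obtain ⟨c, hc, h⟩ := (isCompact_sphere (0 : E) 1).exists_forall_le'
    hφ.continuous.continuousOn (a := 0) (fun v hv => hφ.pos (by rintro rfl; simp at hv))
  refine ⟨c, hc, fun v => ?_⟩
  rcases eq_or_ne v 0 with rfl | hv
  · simp [(hφ.eq_zero_iff 0).2 rfl]
  have hv' := norm_pos_iff.2 hv
  have h1 := h (‖v‖⁻¹ • v) (by simp [norm_smul, inv_mul_cancel₀ hv'.ne'])
  rw [hφ.smul _ _ (inv_nonneg.2 hv'.le), le_inv_mul_iff₀ hv'] at h1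
  linarith

/-- A differentiable deformation of a norm through isometric norms is infinitesimally given by an
endomorphism, unless the norm has a nonzero infinitesimal isometry. -/
theorem IsAsymmetricNorm.exists_infinitesimal_isometry [FiniteDimensional ℝ E]
    (hφ : IsAsymmetricNorm φ) {D : E → E →L[ℝ] ℝ}
    (hD : ∀ x ≠ 0, HasFDerivAt (fun x => φ x ^ 2) (D x) x) {Ψ : ℝ → E → ℝ} {g : E → ℝ} {K : ℝ}
    (hΨ0 : ∀ x, Ψ 0 x = φ x) (hΨg : ∀ x ≠ 0, HasDerivAt (fun t => Ψ t x ^ 2) (g x) 0)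
    (hΨc : ∀ x, ContinuousAt (fun t => Ψ t x) 0)
    (hΨK : ∀ᶠ t in nhdsWithin 0 (Set.Ioi 0), ∀ x, Ψ t x ≤ K * ‖x‖)
    (hΨ : ∀ᶠ t in nhdsWithin 0 (Set.Ioi 0), ∃ B : E →L[ℝ] E, ∀ x, φ (B x) = Ψ t x) :
    ∃ (R : E →L[ℝ] E) (s : ℝ), (R, s) ≠ 0 ∧ ∀ x ≠ 0, D x (R x) = s * g x := by
  -- The isometries are chosen with no regularity in `t`; an ultrafilter makes every bounded family
  -- converge.
  let 𝒰 : Ultrafilter ℝ := Ultrafilter.of (nhdsWithin 0 (Set.Ioi 0))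
  have h𝒰 : (𝒰 : Filter ℝ) ≤ nhdsWithin 0 (Set.Ioi 0) := Ultrafilter.of_le _
  have h𝒰0 : (𝒰 : Filter ℝ) ≤ nhds 0 := h𝒰.trans nhdsWithin_le_nhds
  obtain ⟨B, hB⟩ := hΨ.choice
  replace hB : ∀ᶠ t in (𝒰 : Filter ℝ), ∀ x, φ (B t x) = Ψ t x := h𝒰 hB
  obtain ⟨c, hc, hcφ⟩ := hφ.exists_mul_norm_le
  obtain ⟨B₀, hB₀⟩ := 𝒰.exists_tendsto_of_norm_le (f := B) (M := |K| / c) (by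
    filter_upwards [hB, h𝒰 hΨK] with t ht htK
    refine ContinuousLinearMap.opNorm_le_bound _ (by positivity) fun x => ?_
    rw [div_mul_eq_mul_div, le_div_iff₀ hc, mul_comm]
    calc c * ‖B t x‖ ≤ Ψ t x := (hcφ _).trans_eq (ht x)
      _ ≤ K * ‖x‖ := htK x
      _ ≤ |K| * ‖x‖ := mul_le_mul_of_nonneg_right (le_abs_self K) (norm_nonneg x))
  have hB₀x : ∀ x, Filter.Tendsto (fun t => B t x) 𝒰 (nhds (B₀ x)) := fun x =>
    Filter.Tendsto.clm_apply hB₀ tendsto_const_nhds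
  have hiso : ∀ x, φ (B₀ x) = φ x := by
    intro x
    have h1 : Filter.Tendsto (fun t => φ (B t x)) 𝒰 (nhds (φ (B₀ x))) :=
      (hφ.continuous.tendsto _).comp (hB₀x x)
    have h2 : Filter.Tendsto (fun t => φ (B t x)) 𝒰 (nhds (φ x)) := by
      have h3 := (hΨc x).tendsto.mono_left h𝒰0
      rw [hΨ0] at h3
      exact h3.congr' (hB.mono fun t ht => (ht x).symm)
    exact tendsto_nhds_unique h1 h2
  have hinj : Function.Injective (B₀ : E →ₗ[ℝ] E) := by
    rw [injective_iff_map_eq_zero]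
    intro x hx
    rw [← hφ.eq_zero_iff, ← hiso, hφ.eq_zero_iff]
    exact hx
  let G₀ := (LinearEquiv.ofInjectiveEndo (B₀ : E →ₗ[ℝ] E) hinj)
  let G : E →L[ℝ] E := LinearMap.toContinuousLinearMap (G₀.symm : E →ₗ[ℝ] E)
  have hGB : ∀ x, G (B₀ x) = x := fun x => G₀.symm_apply_apply x
  have hBG : ∀ x, B₀ (G x) = x := fun x => G₀.apply_symm_apply x
  -- The limit `B₀` is itself an isometry; composing with its inverse moves the family to one
  -- tending to the identity.
  let C : ℝ → E →L[ℝ] E := fun t => G.comp (B t) - ContinuousLinearMap.id ℝ E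
  have hC : ∀ t x, x + C t x = G (B t x) := fun t x => by simp [C]
  have hCφ : ∀ t x, φ (x + C t x) = φ (B t x) := fun t x => by
    rw [hC, ← hiso, hBG]
  have hCx : ∀ x, Filter.Tendsto (fun t => x + C t x) 𝒰 (nhds x) := fun x => by
    simp only [hC]
    have := (G.continuous.tendsto _).comp (hB₀x x)
    rwa [hGB] at this
  -- `C t` need not be `O(t)`. Normalizing the pair still gives a nonzero limit; `s = 0` is the case
  -- where `C t` dominates `t`.
  let f : ℝ → (E →L[ℝ] E) × ℝ := fun t => (C t, t)
  have hf : ∀ᶠ t in (𝒰 : Filter ℝ), f t ≠ 0 := by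
    filter_upwards [h𝒰 self_mem_nhdsWithin] with t ht h
    exact (ne_of_gt ht) (Prod.mk_eq_zero.1 h).2
  obtain ⟨⟨R, s⟩, hRs, hlim⟩ := 𝒰.exists_tendsto_normalized hf
  refine ⟨R, s, hRs, fun x hx => ?_⟩
  have o1 : (fun t => φ (x + C t x) ^ 2 - φ x ^ 2 - D x (C t x)) =o[(𝒰 : Filter ℝ)] f := by
    have h1 := (hD x hx).isLittleO.comp_tendsto (hCx x)
    have h2 : (fun t => C t x) =O[(𝒰 : Filter ℝ)] f := by
      refine Asymptotics.IsBigO.of_bound ‖x‖ (Filter.Eventually.of_forall fun t => ?_)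
      calc ‖C t x‖ ≤ ‖C t‖ * ‖x‖ := (C t).le_opNorm x
        _ ≤ ‖x‖ * ‖f t‖ := by
          rw [mul_comm]
          exact mul_le_mul_of_nonneg_left (norm_fst_le (f t)) (norm_nonneg x)
    refine Asymptotics.IsLittleO.trans_isBigO ?_ h2
    refine h1.congr (fun t => ?_) (fun t => ?_) <;> simp
  have o2 : (fun t => Ψ t x ^ 2 - φ x ^ 2 - t * g x) =o[(𝒰 : Filter ℝ)] f := by
    have h1 := (hΨg x hx).isLittleO.mono h𝒰0
    have h2 : (fun t : ℝ => t) =O[(𝒰 : Filter ℝ)] f :=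
      Asymptotics.IsBigO.of_bound 1 (Filter.Eventually.of_forall fun t => by
        rw [one_mul]; exact norm_snd_le (f t))
    refine Asymptotics.IsLittleO.trans_isBigO ?_ h2
    refine h1.congr (fun t => ?_) (fun t => ?_) <;> simp [hΨ0]
  have o3 : (fun t => D x (C t x) - t * g x) =o[(𝒰 : Filter ℝ)] f := by
    refine (o2.sub o1).congr' ?_ Filter.EventuallyEq.rfl
    filter_upwards [hB] with t ht
    rw [hCφ, ht]
    ring
  have o4 : Filter.Tendsto (fun t => ‖f t‖⁻¹ * (D x (C t x) - t * g x)) 𝒰 (nhds 0) := by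
    refine o3.norm_right.tendsto_div_nhds_zero.congr fun t => ?_
    rw [div_eq_inv_mul]
  have o5 : Filter.Tendsto (fun t => ‖f t‖⁻¹ * (D x (C t x) - t * g x)) 𝒰
      (nhds (D x (R x) - s * g x)) := by
    have h1 : Filter.Tendsto (fun t => ‖f t‖⁻¹ • C t) 𝒰 (nhds R) := hlim.fst_nhds
    have h2 : Filter.Tendsto (fun t => ‖f t‖⁻¹ • t) 𝒰 (nhds s) := hlim.snd_nhds
    have h3 := (((D x).continuous.tendsto _).comp (Filter.Tendsto.clm_apply h1 (tendsto_const_nhds (x := x)))).sub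
      (h2.mul_const (g x))
    refine h3.congr fun t => ?_
    simp
    ring
  linarith [tendsto_nhds_unique o5 o4]

end Directions

/-! ### Nearby planes as graphs over a given one. -/

section Grassmannian

/-- The isomorphism of `H` onto a nearby subspace `{x + l x • e | x ∈ H}`. -/
def Submodule.shear {V : Type*} [AddCommGroup V] [Module ℝ V] (H : Submodule ℝ V) (l : H →ₗ[ℝ] ℝ)
    (e : V) : H →ₗ[ℝ] V :=
  H.subtype + l.smulRight e

theorem Submodule.shear_apply {V : Type*} [AddCommGroup V] [Module ℝ V] (H : Submodule ℝ V)
    (l : H →ₗ[ℝ] ℝ) (e : V) (x : H) : H.shear l e x = x + l x • e := rfl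

theorem Submodule.shear_injective {V : Type*} [AddCommGroup V] [Module ℝ V] {H : Submodule ℝ V}
    (l : H →ₗ[ℝ] ℝ) {e : V} (he : e ∉ H) : Function.Injective (H.shear l e) := by
  rw [injective_iff_map_eq_zero]
  intro x hx
  rw [Submodule.shear_apply] at hx
  by_cases hl : l x = 0
  · simpa [hl] using hx
  · refine absurd ?_ he
    have h : e = -((l x)⁻¹ • (x : V)) := by
      rw [eq_neg_of_add_eq_zero_left hx, smul_neg, inv_smul_smul₀ hl, neg_neg]
    rw [h]
    exact H.neg_mem (H.smul_mem _ x.2)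

/-- The sheared basis is a continuous curve of frames, and the quotient topology makes the frames of
members of `U` an open set. -/
theorem Gr.eventually_exists_eq_range_shear {V : Type*} [NormedAddCommGroup V] [NormedSpace ℝ V]
    [FiniteDimensional ℝ V] {k : ℕ} {U : Set (Gr k V)} (hU : IsOpen U) {H : Gr k V} (hH : H ∈ U) {e : V}
    (he : e ∉ H.toSubmodule) (l : H.toSubmodule →ₗ[ℝ] ℝ) :
    ∀ᶠ t : ℝ in nhds 0,
      ∃ H' ∈ U, H'.toSubmodule = LinearMap.range (H.toSubmodule.shear (t • l) e) := by
  let b := Module.finBasisOfFinrankEq ℝ H.toSubmodule H.finrank_eq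
  let F : ℝ → {f : Fin k → V // LinearIndependent ℝ f} := fun t =>
    ⟨fun i => H.toSubmodule.shear (t • l) e (b i),
      b.linearIndependent.map' _ (LinearMap.ker_eq_bot.2 (Submodule.shear_injective _ he))⟩
  have hF : Continuous F := by
    refine Continuous.subtype_mk (continuous_pi fun i => ?_) _
    simp only [Submodule.shear_apply, LinearMap.smul_apply]
    fun_prop
  have hrange : ∀ t, (Gr.ofFrame (F t)).toSubmodule =
      LinearMap.range (H.toSubmodule.shear (t • l) e) := by
    intro t
    have h1 : Set.range (F t).1 = H.toSubmodule.shear (t • l) e '' Set.range b := by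
      rw [← Set.range_comp]; rfl
    rw [LinearMap.range_eq_map, ← b.span_eq, ← Submodule.span_image, ← h1]
    rfl
  have h0 : Gr.ofFrame (F 0) = H := by
    have h1 : (Gr.ofFrame (F 0)).toSubmodule = H.toSubmodule := by
      rw [hrange]
      ext x
      simp [Submodule.shear]
    generalize Gr.ofFrame (F 0) = G at h1
    cases G; cases H
    cases h1
    rfl
  have hopen : IsOpen (Gr.ofFrame ⁻¹' U : Set {f : Fin k → V // LinearIndependent ℝ f}) :=
    isOpen_coinduced.1 hU
  have := (hopen.preimage hF).mem_nhds (show (0 : ℝ) ∈ F ⁻¹' (Gr.ofFrame ⁻¹' U) by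
    rw [Set.mem_preimage, Set.mem_preimage, h0]; exact hH)
  filter_upwards [this] with t ht
  exact ⟨_, ht, hrange t⟩

variable {V : Type*} [NormedAddCommGroup V] [NormedSpace ℝ V] {Φ : V → ℝ}

theorem IsAsymmetricNorm.restrict {E : Type*} [AddCommGroup E] [Module ℝ E] {Φ : E → ℝ}
    (hΦ : IsAsymmetricNorm Φ) (H : Submodule ℝ E) : IsAsymmetricNorm fun v : H => Φ v where
  nonneg v := hΦ.nonneg v
  eq_zero_iff v := by rw [hΦ.eq_zero_iff, Submodule.coe_eq_zero]
  smul t v ht := hΦ.smul t v ht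
  add_le v w := hΦ.add_le v w

theorem IsEuclideanNorm.of_areIsometric {E F : Type*} [AddCommGroup E] [Module ℝ E]
    [AddCommGroup F] [Module ℝ F] {φ : E → ℝ} {ψ : F → ℝ} (h : AreIsometric φ ψ)
    (hψ : IsEuclideanNorm ψ) : IsEuclideanNorm φ := by
  obtain ⟨L, hL⟩ := h
  obtain ⟨c, hc⟩ := hψ
  refine ⟨{ inner := fun u v => c.inner (L u) (L v)
            conj_inner_symm := fun u v => c.conj_inner_symm _ _
            re_inner_nonneg := fun u => c.re_inner_nonneg _
            add_left := fun u v w => by rw [map_add]; exact c.add_left _ _ _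
            smul_left := fun u v r => by rw [map_smul]; exact c.smul_left _ _ _
            definite := fun u hu => L.map_eq_zero_iff.1 (c.definite _ hu) }, fun v => ?_⟩
  rw [← hL, hc]
  rfl

theorem Submodule.hasDerivAt_shear {H : Submodule ℝ V} (l : H →ₗ[ℝ] ℝ) (e : V) (x : H) :
    HasDerivAt (fun t : ℝ => H.shear (t • l) e x) (l x • e) 0 := by
  simp only [Submodule.shear_apply, LinearMap.smul_apply, smul_eq_mul, mul_smul]
  simpa using ((hasDerivAt_id (0 : ℝ)).smul_const (l x • e)).const_add (x : V)

theorem Submodule.shear_zero_smul {H : Submodule ℝ V} (l : H →ₗ[ℝ] ℝ) (e : V) (x : H) :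
    H.shear ((0 : ℝ) • l) e x = x := by
  simp [Submodule.shear_apply]

/-! ### Differentiating the isometries and the conjugate directions. -/

namespace IsBanachMinkowskiNorm

theorem contDiffAt_sq (hΦ : IsBanachMinkowskiNorm Φ) {x : V} (hx : x ≠ 0) :
    ContDiffAt ℝ ∞ (fun x => Φ x ^ 2) x :=
  (hΦ.smooth.pow 2).contDiffAt (isOpen_compl_singleton.mem_nhds hx)

theorem hasFDerivAt_sq (hΦ : IsBanachMinkowskiNorm Φ) {x : V} (hx : x ≠ 0) :
    HasFDerivAt (fun x => Φ x ^ 2) (fderiv ℝ (fun x => Φ x ^ 2) x) x :=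
  ((hΦ.contDiffAt_sq hx).differentiableAt (by simp)).hasFDerivAt

theorem differentiableAt_fderiv_sq (hΦ : IsBanachMinkowskiNorm Φ) {x : V} (hx : x ≠ 0) :
    DifferentiableAt ℝ (fderiv ℝ fun x => Φ x ^ 2) x :=
  ((hΦ.contDiffAt_sq hx).fderiv_right (m := 1) (by norm_cast)).differentiableAt (by simp)

/-- The differential of the squared norm of a subspace. -/
noncomputable def _root_.Submodule.fderivSq (H : Submodule ℝ V) (Φ : V → ℝ) (x : H) : H →L[ℝ] ℝ :=
  (fderiv ℝ (fun x => Φ x ^ 2) x).comp H.subtypeL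

theorem hasFDerivAt_sq_restrict (hΦ : IsBanachMinkowskiNorm Φ) (H : Submodule ℝ V) {x : H}
    (hx : x ≠ 0) : HasFDerivAt (fun x : H => Φ x ^ 2) (H.fderivSq Φ x) x :=
  (hΦ.hasFDerivAt_sq (by simpa using hx)).comp x H.subtypeL.hasFDerivAt

theorem continuousOn_fderivSq (hΦ : IsBanachMinkowskiNorm Φ) (H : Submodule ℝ V) :
    ContinuousOn (H.fderivSq Φ) {0}ᶜ := by
  intro x hx
  have h1 : ContinuousAt (fderiv ℝ fun x => Φ x ^ 2) (x : V) :=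
    (hΦ.differentiableAt_fderiv_sq (by simpa using hx)).continuousAt
  have h2 : ContinuousAt (fun x : H => fderiv ℝ (fun x => Φ x ^ 2) (x : V)) x :=
    ContinuousAt.comp (f := fun x : H => (x : V)) h1 continuous_subtype_val.continuousAt
  exact (h2.clm_comp continuousAt_const).continuousWithinAt

variable [FiniteDimensional ℝ V]

theorem exists_infinitesimal_isometry (hΦ : IsBanachMinkowskiNorm Φ) {k : ℕ} {U : Set (Gr k V)}
    (hU : IsOpen U)
    (hiso : ∀ H ∈ U, ∀ H' ∈ U, AreIsometric (Gr.restrict Φ H) (Gr.restrict Φ H'))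
    {H : Gr k V} (hH : H ∈ U) {e : V} (he : e ∉ H.toSubmodule) (l : H.toSubmodule →ₗ[ℝ] ℝ) :
    ∃ (R : H.toSubmodule →L[ℝ] H.toSubmodule) (s : ℝ), (R, s) ≠ 0 ∧ ∀ x ≠ 0,
      H.toSubmodule.fderivSq Φ x (R x) =
        s * (l x * fderiv ℝ (fun x => Φ x ^ 2) (x : V) e) := by
  obtain ⟨K, hK0, hK⟩ := hΦ.toIsAsymmetricNorm.exists_le_mul_norm
  have hc := hΦ.toIsAsymmetricNorm.continuous
  refine (hΦ.toIsAsymmetricNorm.restrict H.toSubmodule).exists_infinitesimal_isometry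
    (fun x hx => hΦ.hasFDerivAt_sq_restrict _ hx)
    (Ψ := fun t x => Φ (H.toSubmodule.shear (t • l) e x))
    -- Bounds `Φ (x + t l(x) e)` uniformly for `0 < t < 1`.
    (K := K * (1 + ‖LinearMap.toContinuousLinearMap l‖ * ‖e‖))
    (fun x => by rw [Submodule.shear_zero_smul]) (fun x hx => ?_) (fun x => ?_) ?_ ?_
  · have h1 := hΦ.hasFDerivAt_sq (x := (x : V)) (by simpa using hx)
    rw [← Submodule.shear_zero_smul l e x] at h1
    have h2 := h1.comp_hasDerivAt (0 : ℝ) (Submodule.hasDerivAt_shear l e x)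
    rw [Submodule.shear_zero_smul, map_smul, smul_eq_mul] at h2
    exact h2
  · exact ContinuousAt.comp (f := fun t : ℝ => H.toSubmodule.shear (t • l) e x)
      hc.continuousAt (Submodule.hasDerivAt_shear l e x).continuousAt
  · filter_upwards [Ioo_mem_nhdsGT (zero_lt_one' ℝ)] with t ht x
    refine (hK _).trans ?_
    rw [mul_assoc]
    refine mul_le_mul_of_nonneg_left ?_ hK0
    rw [Submodule.shear_apply]
    have h1 : ‖(t • l) x‖ ≤ ‖LinearMap.toContinuousLinearMap l‖ * ‖x‖ := by
      rw [LinearMap.smul_apply, norm_smul, Real.norm_of_nonneg ht.1.le]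
      have h2 := (LinearMap.toContinuousLinearMap l).le_opNorm x
      have h3 : t * ‖l x‖ ≤ 1 * ‖l x‖ := mul_le_mul_of_nonneg_right ht.2.le (norm_nonneg _)
      rw [one_mul] at h3
      exact h3.trans h2
    calc ‖(x : V) + (t • l) x • e‖ ≤ ‖(x : V)‖ + ‖(t • l) x‖ * ‖e‖ := by
          rw [← norm_smul]; exact norm_add_le _ _
      _ ≤ ‖x‖ + ‖LinearMap.toContinuousLinearMap l‖ * ‖x‖ * ‖e‖ :=
          add_le_add le_rfl (mul_le_mul_of_nonneg_right h1 (norm_nonneg _))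
      _ = (1 + ‖LinearMap.toContinuousLinearMap l‖ * ‖e‖) * ‖x‖ := by ring
  · filter_upwards [nhdsWithin_le_nhds (Gr.eventually_exists_eq_range_shear hU hH he l)] with t ht
    obtain ⟨H', hH', hr⟩ := ht
    obtain ⟨L, hL⟩ := hiso H hH H' hH'
    let S := (H.toSubmodule.shear (t • l) e).codRestrict H'.toSubmodule
      (fun x => by rw [hr]; exact LinearMap.mem_range_self _ x)
    refine ⟨LinearMap.toContinuousLinearMap (L.symm.toLinearMap ∘ₗ S), fun x => ?_⟩
    have h1 := hL (L.symm (S x))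
    rw [L.apply_symm_apply] at h1
    exact h1.symm

/-- If isometric planes fill an open set and are not Euclidean, the intersection of the unit sphere
with each of them is a shadow boundary. -/
theorem exists_conjugate_direction (hV : Module.finrank ℝ V = 3) (hΦ : IsBanachMinkowskiNorm Φ)
    {U : Set (Gr 2 V)} (hU : IsOpen U)
    (hiso : ∀ H ∈ U, ∀ H' ∈ U, AreIsometric (Gr.restrict Φ H) (Gr.restrict Φ H'))
    {H : Gr 2 V} (hH : H ∈ U) (hne : ¬ IsEuclideanNorm (Gr.restrict Φ H)) :
    ∃ e ≠ 0, ∀ x ∈ H.toSubmodule, x ≠ 0 → fderiv ℝ (fun x => Φ x ^ 2) x e = 0 := by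
  have hφ := hΦ.toIsAsymmetricNorm.restrict H.toSubmodule
  have hD : ∀ x ≠ 0, HasFDerivAt (fun x : H.toSubmodule => Φ x ^ 2) (H.toSubmodule.fderivSq Φ x) x :=
    fun x hx => hΦ.hasFDerivAt_sq_restrict _ hx
  obtain ⟨e, he⟩ : ∃ e, e ∉ H.toSubmodule := by
    by_contra! h
    have h1 : H.toSubmodule = ⊤ := Submodule.eq_top_iff'.2 h
    have h2 := H.finrank_eq
    rw [h1, finrank_top, hV] at h2
    omega
  let b := Module.finBasisOfFinrankEq ℝ H.toSubmodule H.finrank_eq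
  have hR : ∀ i, ∃ R : H.toSubmodule →ₗ[ℝ] H.toSubmodule, ∀ x ≠ 0,
      H.toSubmodule.fderivSq Φ x (R x) =
        b.coord i x * fderiv ℝ (fun x => Φ x ^ 2) (x : V) e := by
    intro i
    obtain ⟨R, s, hRs, h⟩ := hΦ.exists_infinitesimal_isometry hU hiso hH he (b.coord i)
    -- If `s = 0`, then `R` is a nonzero infinitesimal isometry and the plane is Euclidean.
    have hs : s ≠ 0 := by
      rintro rfl
      refine hne (hφ.isEuclideanNorm_of_linear H.finrank_eq hD (A := R) (fun hR => hRs ?_)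
        (fun x hx => ?_))
      · rw [Prod.mk_eq_zero]
        exact ⟨ContinuousLinearMap.coe_injective hR, rfl⟩
      · rw [ContinuousLinearMap.coe_coe, h x hx, zero_mul]
    refine ⟨s⁻¹ • R, fun x hx => ?_⟩
    rw [LinearMap.smul_apply, map_smul, ContinuousLinearMap.coe_coe, h x hx, smul_eq_mul,
      inv_mul_cancel_left₀ hs]
  choose R hR using hR
  -- This combination cancels the terms containing `e`.
  let B : H.toSubmodule →ₗ[ℝ] H.toSubmodule →ₗ[ℝ] H.toSubmodule :=
    (b.coord 1).smulRight (R 0) - (b.coord 0).smulRight (R 1)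
  have hBapp : ∀ x, B x x = b.coord 1 x • R 0 x - b.coord 0 x • R 1 x := fun x => rfl
  have hB : ∀ x, B x x = 0 := by
    by_contra! h
    refine hne (hφ.isEuclideanNorm_of_quadratic H.finrank_eq hD (hΦ.continuousOn_fderivSq _) h
      fun x hx => ?_)
    rw [hBapp, map_sub, map_smul, map_smul, hR 0 x hx, hR 1 x hx, smul_eq_mul, smul_eq_mul]
    ring
  have c00 : b.coord 0 (b 0) = 1 := by simp
  have c01 : b.coord 0 (b 1) = 0 := by simp
  have c10 : b.coord 1 (b 0) = 0 := by simp
  have c11 : b.coord 1 (b 1) = 1 := by simp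
  have r10 : R 1 (b 0) = 0 := by
    have := hB (b 0)
    rw [hBapp, c00, c10] at this
    simpa using this
  have r01 : R 0 (b 1) = 0 := by
    have := hB (b 1)
    rw [hBapp, c01, c11] at this
    simpa using this
  have r : R 1 (b 1) = R 0 (b 0) := by
    have := hB (b 0 + b 1)
    rw [hBapp, map_add, map_add, map_add, map_add, c00, c01, c10, c11, r10, r01] at this
    simp only [add_zero, zero_add, one_smul] at this
    exact (sub_eq_zero.1 this).symm
  -- Vanishing of `B x x` at `b 0`, `b 1` and `b 0 + b 1` determines both maps from the one vector
  -- `R 0 (b 0)`.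
  have hRw : ∀ i x, R i x = b.coord i x • R 0 (b 0) := by
    intro i x
    conv_lhs => rw [b.eq_add_fin_two x, map_add, map_smul, map_smul]
    fin_cases i
    · simp [r01]
    · simp [r10, r]
  refine ⟨e - R 0 (b 0), fun h => he ?_, fun x hx hx0 => ?_⟩
  · rw [sub_eq_zero.1 h]
    exact (R 0 (b 0)).2
  · set z : H.toSubmodule := ⟨x, hx⟩ with hz
    have hz0 : z ≠ 0 := fun h => hx0 (congrArg Subtype.val h)
    have h1 : ∀ i, b.coord i z * fderiv ℝ (fun x => Φ x ^ 2) x (e - R 0 (b 0)) = 0 := by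
      intro i
      have h2 := hR i z hz0
      rw [hRw, map_smul, smul_eq_mul] at h2
      have h3 : H.toSubmodule.fderivSq Φ z (R 0 (b 0)) =
        fderiv ℝ (fun x => Φ x ^ 2) x (R 0 (b 0)) := rfl
      rw [h3] at h2
      rw [map_sub, mul_sub, h2, sub_self]
    by_contra hne'
    have h4 : ∀ i, b.coord i z = 0 := fun i => (mul_eq_zero.1 (h1 i)).resolve_right hne'
    apply hz0
    rw [b.eq_add_fin_two z, h4, h4, zero_smul, zero_smul, add_zero]

/-- Let `v = w + α e` be conjugate to the tilted plane. At the tilted point `dP(e)` is `t l(x)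
P''(e, e) + o(t)`, as it vanishes for `t = 0`. So `dP(w) + α dP(e) = 0` becomes, in the limit, a
relation between the normalized limits of `w` and `t α`. -/
theorem exists_derivative_of_conjugate_direction (hΦ : IsBanachMinkowskiNorm Φ)
    {H : Submodule ℝ V} {e : V}
    (hHe : ∀ v : V, ∃ (w : H) (α : ℝ), v = w + α • e)
    (hconj : ∀ x ∈ H, x ≠ 0 → fderiv ℝ (fun x => Φ x ^ 2) x e = 0)
    (l : H →ₗ[ℝ] ℝ)
    (hl : ∀ᶠ t : ℝ in nhds 0, ∃ v ≠ 0, ∀ x : H, x ≠ 0 →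
      fderiv ℝ (fun x => Φ x ^ 2) (H.shear (t • l) e x) v = 0) :
    ∃ W : H, ∀ x ≠ 0, H.fderivSq Φ x W =
      l x * fderiv ℝ (fderiv ℝ fun x => Φ x ^ 2) (x : V) e e := by
  let P' := fderiv ℝ fun x => Φ x ^ 2
  let 𝒰 : Ultrafilter ℝ := Ultrafilter.of (nhdsWithin 0 (Set.Ioi 0))
  have h𝒰 : (𝒰 : Filter ℝ) ≤ nhdsWithin 0 (Set.Ioi 0) := Ultrafilter.of_le _
  have h𝒰0 : (𝒰 : Filter ℝ) ≤ nhds 0 := h𝒰.trans nhdsWithin_le_nhds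
  obtain ⟨v, hv⟩ := hl.choice
  replace hv := h𝒰0 hv
  choose w α hwα using fun t => hHe (v t)
  -- The weight `t` matches the first-order decay of `dP(e)`; neither continuity nor a normalization
  -- of `v` is needed.
  let f : ℝ → H × ℝ := fun t => (w t, t * α t)
  have hf : ∀ᶠ t in (𝒰 : Filter ℝ), f t ≠ 0 := by
    filter_upwards [h𝒰 self_mem_nhdsWithin, hv] with t ht hvt h
    obtain ⟨h1, h2⟩ := Prod.mk_eq_zero.1 h
    have h3 : α t = 0 := (mul_eq_zero.1 h2).resolve_left (ne_of_gt ht)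
    apply hvt.1
    rw [hwα, h1, h3]
    simp
  obtain ⟨⟨W, s⟩, hWs, hlim⟩ := 𝒰.exists_tendsto_normalized hf
  have key : ∀ x : H, x ≠ 0 → P' x W + s * (l x * fderiv ℝ P' (x : V) e e) = 0 := by
    intro x hx
    have hx' : (x : V) ≠ 0 := by simpa using hx
    have hz : H.shear 0 e x = x := by simpa using Submodule.shear_zero_smul l e x
    have hP' : HasFDerivAt P' (fderiv ℝ P' x) (H.shear ((0 : ℝ) • l) e x) := by
      rw [Submodule.shear_zero_smul]; exact (hΦ.differentiableAt_fderiv_sq hx').hasFDerivAt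
    have hder := hP'.comp_hasDerivAt (0 : ℝ) (Submodule.hasDerivAt_shear l e x)
    have t1 : Filter.Tendsto (fun t : ℝ => P' (H.shear (t • l) e x)) 𝒰 (nhds (P' x)) := by
      have := hder.continuousAt.tendsto.mono_left h𝒰0
      simpa [hz, Function.comp_def] using this
    have t2 : Filter.Tendsto (fun t : ℝ => t⁻¹ * P' (H.shear (t • l) e x) e) 𝒰
        (nhds (l x * fderiv ℝ P' (x : V) e e)) := by
      have h1 := (hder.clm_apply (hasDerivAt_const (0 : ℝ) e)).tendsto_slope_zero_right.mono_left h𝒰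
      have h2 : P' x e = 0 := hconj x x.2 hx'
      simpa [hz, Function.comp_def, h2] using h1
    have h1 : Filter.Tendsto (fun t => ((‖f t‖⁻¹ • w t : H) : V)) 𝒰 (nhds (W : V)) :=
      (continuous_subtype_val.tendsto W).comp hlim.fst_nhds
    have h2 : Filter.Tendsto (fun t => ‖f t‖⁻¹ • (t * α t)) 𝒰 (nhds s) := hlim.snd_nhds
    have t3 := (t1.clm_apply h1).add (h2.mul t2)
    refine tendsto_nhds_unique t3 (tendsto_const_nhds.congr' ?_)
    filter_upwards [h𝒰 self_mem_nhdsWithin, hv] with t ht hvt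
    have ht0 : t ≠ 0 := ne_of_gt ht
    have h3 : P' (H.shear (t • l) e x) (w t + α t • e) = 0 := by
      rw [← hwα]; exact hvt.2 x hx
    rw [map_add, map_smul, smul_eq_mul] at h3
    rw [Submodule.coe_smul, map_smul, smul_eq_mul, smul_eq_mul]
    have h4 : ‖f t‖⁻¹ * (t * α t) * (t⁻¹ * P' (H.shear (t • l) e x) e) =
        ‖f t‖⁻¹ * (α t * P' (H.shear (t • l) e x) e) := by
      field_simp
    rw [h4, ← mul_add, h3, mul_zero]
  -- Otherwise `W ≠ 0` and `dP_x(W) = 0` for all nonzero `x ∈ H`, which contradicts Euler's identity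
  -- at `x = W`.
  have hs : s ≠ 0 := by
    rintro rfl
    have hW : W ≠ 0 := fun h => hWs (by rw [h]; rfl)
    have h1 := key W hW
    rw [zero_mul, add_zero] at h1
    have hW' : (W : V) ≠ 0 := by simpa using hW
    exact one_ne_zero (hΦ.toIsAsymmetricNorm.eq_zero_of_apply_smul (hΦ.hasFDerivAt_sq hW') hW'
      (μ := 1) (by rw [one_smul]; exact h1))
  refine ⟨-(s⁻¹ • W), fun x hx => ?_⟩
  have h1 := key x hx
  have h2 : H.fderivSq Φ x W = -(s * (l x * fderiv ℝ P' (x : V) e e)) := by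
    rw [← eq_neg_iff_add_eq_zero] at h1; exact h1
  rw [map_neg, map_smul, h2, smul_eq_mul, mul_neg, neg_neg, inv_mul_cancel_left₀ hs]

end IsBanachMinkowskiNorm

end Grassmannian

/-! ### Conclusion by strict convexity. -/

theorem propositionp {V : Type*} [NormedAddCommGroup V] [NormedSpace ℝ V]
    (hV : Module.finrank ℝ V = 3) (Φ : V → ℝ) (hΦ : IsBanachMinkowskiNorm Φ)
    (U : Set (Gr 2 V)) (hU : IsOpen U)
    (hiso : ∀ H ∈ U, ∀ H' ∈ U, AreIsometric (Gr.restrict Φ H) (Gr.restrict Φ H')) :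
    ∀ H ∈ U, IsEuclideanNorm (Gr.restrict Φ H) := by
  intro H hH
  have : FiniteDimensional ℝ V := Module.finite_of_finrank_pos (by omega)
  by_contra hne
  have hconj : ∀ H' ∈ U, ∃ e ≠ 0, ∀ x ∈ H'.toSubmodule, x ≠ 0 →
      fderiv ℝ (fun x => Φ x ^ 2) x e = 0 := fun H' hH' =>
    hΦ.exists_conjugate_direction hV hU hiso hH' fun h =>
      hne (h.of_areIsometric (hiso H hH H' hH'))
  obtain ⟨e, he0, he⟩ := hconj H hH
  have heH : e ∉ H.toSubmodule := fun h => by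
    have h1 := hΦ.toIsAsymmetricNorm.euler (hΦ.hasFDerivAt_sq he0)
    rw [he e h he0] at h1
    have := hΦ.toIsAsymmetricNorm.pos he0
    have : 0 < 2 * Φ e ^ 2 := by positivity
    linarith
  have hHe : ∀ v : V, ∃ (w : H.toSubmodule) (α : ℝ), v = w + α • e := by
    have h1 : H.toSubmodule ⊔ Submodule.span ℝ {e} = ⊤ := by
      refine Submodule.eq_top_of_finrank_eq (le_antisymm (Submodule.finrank_le _) ?_)
      have h2 : H.toSubmodule < H.toSubmodule ⊔ Submodule.span ℝ {e} := by
        refine lt_of_le_of_ne le_sup_left fun h => heH ?_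
        rw [h]
        exact Submodule.mem_sup_right (Submodule.mem_span_singleton_self e)
      have := Submodule.finrank_lt_finrank_of_lt h2
      rw [H.finrank_eq] at this
      omega
    intro v
    obtain ⟨w, hw, z, hz, h⟩ := Submodule.mem_sup.1 (h1.ge (Submodule.mem_top (x := v)))
    obtain ⟨α, rfl⟩ := Submodule.mem_span_singleton.1 hz
    exact ⟨⟨w, hw⟩, α, h.symm⟩
  let b := Module.finBasisOfFinrankEq ℝ H.toSubmodule H.finrank_eq
  have hW : ∀ i, ∃ W : H.toSubmodule, ∀ x ≠ 0, H.toSubmodule.fderivSq Φ x W =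
      b.coord i x * fderiv ℝ (fderiv ℝ fun x => Φ x ^ 2) (x : V) e e := by
    intro i
    refine hΦ.exists_derivative_of_conjugate_direction hHe he (b.coord i) ?_
    filter_upwards [Gr.eventually_exists_eq_range_shear hU hH heH (b.coord i)] with t ht
    obtain ⟨H', hH', hr⟩ := ht
    obtain ⟨v, hv0, hv⟩ := hconj H' hH'
    refine ⟨v, hv0, fun x hx => hv _ (by rw [hr]; exact LinearMap.mem_range_self _ x) ?_⟩
    rw [Ne, map_eq_zero_iff _ (Submodule.shear_injective _ heH)]
    exact hx
  choose W hW using hW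
  -- This combination cancels `P''(e, e)`.
  let A : H.toSubmodule →ₗ[ℝ] H.toSubmodule :=
    (b.coord 1).smulRight (W 0) - (b.coord 0).smulRight (W 1)
  have hAapp : ∀ x, A x = b.coord 1 x • W 0 - b.coord 0 x • W 1 := fun x => rfl
  by_cases hA : A = 0
  -- Here `W 0 = A (b 1) = 0`, so the relation at `b 0` reads `P''(e, e) = 0`.
  · have h1 : W 0 = 0 := by
      have := hAapp (b 1)
      rw [hA] at this
      simpa using this.symm
    have h2 := hW 0 (b 0) (b.ne_zero 0)
    have h3 := hΦ.strictConvex (b 0 : V) e (by simpa using b.ne_zero 0) he0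
    rw [h1, map_zero, b.coord_apply, b.repr_self, Finsupp.single_eq_same, one_mul] at h2
    exact h3.ne h2
  · refine hne ((hΦ.toIsAsymmetricNorm.restrict H.toSubmodule).isEuclideanNorm_of_linear
      H.finrank_eq (fun x hx => hΦ.hasFDerivAt_sq_restrict _ hx) hA fun x hx => ?_)
    rw [hAapp, map_sub, map_smul, map_smul, hW 0 x hx, hW 1 x hx, smul_eq_mul, smul_eq_mul]
    ring
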